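/- Let $D\subset\mathbb R^d$ be a bounded open set, and let $\alpha>0$, $\beta\ge 0$, $0<\kappa<1$, $\epsilon>0$, $\lambda_c\in\mathbb R$, $c_w=8/3$, $\rho=\lambda_c\epsilon/c_w$, $\delta=\lambda_c/(c_w\epsilon)$. Let $\mathbb V=H^1(D)$ with its usual norm and $\mathbb V_T=H^1(D)\cap L^\infty(D)$ with the norm $\|\varphi\|_{H^1(D)}+\|\varphi\|_{L^\infty(D)}$. For $u\in\mathbb V$, $v\in\mathbb V_T$ put $$T=T(u,v)=\sqrt{(1-\kappa)v^2+\kappa}\;\nabla u,\qquad J(u,v)=\int_D\Big[\frac{|T|^2}{2\,(1+\beta^\alpha|T|^{2\alpha})^{1/\alpha}}+\rho\,|\nabla v|^2+\delta\,(1-v)\Big]dx .$$ **Proposition.** For all $(u,v)\in\mathbb V\times\mathbb V_T$ and $(\psi,\varphi)\in\mathbb V\times\mathbb V_T$, the integral defining $J(u,v)$ and the integrals $$A(v;u,\psi)=\int_D\frac{(1-\kappa)v^2+\kappa}{(1+\beta^\alpha|T|^{2\alpha})^{\frac1\alpha+1}}\,\nabla u\cdot\nabla\psi\,dx,$$ $$B(u;v,\varphi)=\int_D\Big[2\rho\,\nabla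 v\cdot\nabla\varphi-\delta\,\varphi+\frac{(1-\kappa)|\nabla u|^2}{(1+\beta^\alpha|T|^{2\alpha})^{\frac1\alpha+1}}\,v\,\varphi\Big]dx$$ converge absolutely, and the functional $J:\mathbb V\times\mathbb V_T\to\mathbb R$ is Fréchet differentiable at every $(u,v)\in\mathbb V\times\mathbb V_T$; its derivative is the bounded linear functional $$J'(u,v;\psi,\varphi)=A(v;u,\psi)+B(u;v,\varphi).$$ -/

import Mathlib

open MeasureTheory
open scoped ENNReal ContDiff

namespace PhaseField

/-- `ℝ^d` with its Euclidean norm. -/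
abbrev Sp (d : ℕ) : Type := EuclideanSpace ℝ (Fin d)

/-- The vector field `g` is a weak (distributional) gradient of `f` on the open set `D`:
`∫_D f ∂ᵢζ = - ∫_D gᵢ ζ` for every `i` and every test function `ζ ∈ C_c^∞(D)`. -/
def IsWeakGrad {d : ℕ} (D : Set (Sp d)) (f : Sp d → ℝ) (g : Sp d → Sp d) : Prop :=
  ∀ ζ : Sp d → ℝ, ContDiff ℝ ∞ ζ → HasCompactSupport ζ → tsupport ζ ⊆ D → ∀ i : Fin d,
    ∫ x in D, f x * fderiv ℝ ζ x (EuclideanSpace.single i 1) = - ∫ x in D, g x i * ζ x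

/-- `L²(D) × L²(D; ℝ^d)` with the norm `(‖f‖² + ‖g‖²)^{1/2}`. -/
abbrev L2Pair {d : ℕ} (D : Set (Sp d)) : Type :=
  WithLp 2 (Lp ℝ 2 (volume.restrict D) × Lp (Sp d) 2 (volume.restrict D))

theorem memLp_test {d : ℕ} {D : Set (Sp d)} {ζ : Sp d → ℝ} (h : Continuous ζ)
    (hc : HasCompactSupport ζ) : MemLp ζ 2 (volume.restrict D) :=
  (h.memLp_of_hasCompactSupport hc).restrict D

theorem memLp_dtest {d : ℕ} {D : Set (Sp d)} {ζ : Sp d → ℝ} (h : ContDiff ℝ ∞ ζ)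
    (hc : HasCompactSupport ζ) (i : Fin d) :
    MemLp (fun x => fderiv ℝ ζ x (EuclideanSpace.single i 1)) 2 (volume.restrict D) :=
  memLp_test ((h.continuous_fderiv (by simp)).clm_apply continuous_const)
    (hc.fderiv_apply ℝ (EuclideanSpace.single i 1))

theorem memLp_comp {d : ℕ} {D : Set (Sp d)} {g : Sp d → Sp d}
    (h : MemLp g 2 (volume.restrict D)) (i : Fin d) :
    MemLp (fun x => g x i) 2 (volume.restrict D) :=
  (EuclideanSpace.proj (𝕜 := ℝ) i).comp_memLp' h

theorem IsWeakGrad.congr {d : ℕ} {D : Set (Sp d)} {f f' : Sp d → ℝ} {g g' : Sp d → Sp d}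
    (h : IsWeakGrad D f g) (hf : f =ᵐ[volume.restrict D] f') (hg : g =ᵐ[volume.restrict D] g') :
    IsWeakGrad D f' g' := by
  intro ζ h1 h2 h3 i
  have e1 : ∫ x in D, f' x * fderiv ℝ ζ x (EuclideanSpace.single i 1)
      = ∫ x in D, f x * fderiv ℝ ζ x (EuclideanSpace.single i 1) :=
    integral_congr_ae (by filter_upwards [hf] with x hx; rw [hx])
  have e2 : ∫ x in D, g' x i * ζ x = ∫ x in D, g x i * ζ x :=
    integral_congr_ae (by filter_upwards [hg] with x hx; rw [hx])
  rw [e1, e2]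
  exact h ζ h1 h2 h3 i

theorem IsWeakGrad.add {d : ℕ} {D : Set (Sp d)} {f f' : Sp d → ℝ} {g g' : Sp d → Sp d}
    (mf : MemLp f 2 (volume.restrict D)) (mf' : MemLp f' 2 (volume.restrict D))
    (mg : MemLp g 2 (volume.restrict D)) (mg' : MemLp g' 2 (volume.restrict D))
    (h : IsWeakGrad D f g) (h' : IsWeakGrad D f' g') : IsWeakGrad D (f + f') (g + g') := by
  intro ζ h1 h2 h3 i
  have a := memLp_dtest (D := D) h1 h2 i
  have b := memLp_test (D := D) h1.continuous h2
  have e1 := integral_add (mf.integrable_mul a) (mf'.integrable_mul a)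
  have e2 := integral_add ((memLp_comp mg i).integrable_mul b)
    ((memLp_comp mg' i).integrable_mul b)
  have k := h ζ h1 h2 h3 i
  have k' := h' ζ h1 h2 h3 i
  simp only [Pi.mul_apply] at e1 e2
  simp only [Pi.add_apply, PiLp.add_apply, add_mul]
  rw [e1, e2, k, k']
  ring

theorem IsWeakGrad.smul {d : ℕ} {D : Set (Sp d)} {f : Sp d → ℝ} {g : Sp d → Sp d} (c : ℝ)
    (h : IsWeakGrad D f g) : IsWeakGrad D (c • f) (c • g) := by
  intro ζ h1 h2 h3 i
  have k := h ζ h1 h2 h3 i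
  simp only [Pi.smul_apply, PiLp.smul_apply, smul_eq_mul, mul_assoc]
  rw [integral_const_mul, integral_const_mul, k]
  ring

/-- On an open set the weak gradient is unique almost everywhere. -/
theorem IsWeakGrad.unique {d : ℕ} {D : Set (Sp d)} (hD : IsOpen D) {f : Sp d → ℝ}
    {g g' : Sp d → Sp d} (mg : MemLp g 2 (volume.restrict D))
    (mg' : MemLp g' 2 (volume.restrict D)) (h : IsWeakGrad D f g) (h' : IsWeakGrad D f g') :
    g =ᵐ[volume.restrict D] g' := by
  have key : ∀ i : Fin d, ∀ᵐ x ∂(volume.restrict D), g x i = g' x i := by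
    intro i
    have m := (memLp_comp mg i).sub (memLp_comp mg' i)
    have loc : LocallyIntegrableOn (fun x => g x i - g' x i) D volume :=
      fun x hx => by
        have l : LocallyIntegrable (fun x => g x i - g' x i) (volume.restrict D) :=
          m.locallyIntegrable (by norm_num)
        exact (locallyIntegrableOn_of_locallyIntegrable_restrict l) x hx
    have z := hD.ae_eq_zero_of_integral_contDiff_smul_eq_zero loc (fun ζ h1 h2 h3 => by
      have b := memLp_test (D := D) h1.continuous h2
      have k := h ζ h1 h2 h3 i
      have k' := h' ζ h1 h2 h3 i
      have e := integral_sub ((memLp_comp mg i).integrable_mul b)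
        ((memLp_comp mg' i).integrable_mul b)
      simp only [Pi.mul_apply] at e
      have s : ∫ x in D, ζ x • (g x i - g' x i) = ∫ x, ζ x • (g x i - g' x i) := by
        apply setIntegral_eq_integral_of_forall_compl_eq_zero
        intro x hx
        have : ζ x = 0 := image_eq_zero_of_notMem_tsupport fun hh => hx (h3 hh)
        simp [this]
      rw [← s]
      have t : ∀ x, ζ x • (g x i - g' x i) = g x i * ζ x - g' x i * ζ x := by
        intro x; simp only [smul_eq_mul]; ring
      simp only [t]
      rw [e]
      linarith)
    rw [ae_restrict_iff' hD.measurableSet]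
    filter_upwards [z] with x hx hxD
    exact sub_eq_zero.mp (hx hxD)
  filter_upwards [ae_all_iff.mpr key] with x hx
  ext i
  exact hx i

/-- The Sobolev space `H¹(D) = W^{1,2}(D)`, realised as the space of pairs `(f, ∇f)` with
`f ∈ L²(D)` whose weak gradient `∇f` lies in `L²(D; ℝ^d)`. -/
def H1Submodule {d : ℕ} (D : Set (Sp d)) : Submodule ℝ (L2Pair D) where
  carrier := {p | IsWeakGrad D p.fst p.snd}
  zero_mem' := by
    have h : IsWeakGrad D (fun _ => (0 : ℝ)) (fun _ => (0 : Sp d)) := by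
      intro ζ _ _ _ i
      simp
    exact h.congr (Lp.coeFn_zero ℝ 2 _).symm (Lp.coeFn_zero (Sp d) 2 _).symm
  add_mem' := by
    intro p q hp hq
    exact (IsWeakGrad.add (Lp.memLp _) (Lp.memLp _) (Lp.memLp _) (Lp.memLp _) hp hq).congr
      (Lp.coeFn_add p.fst q.fst).symm (Lp.coeFn_add p.snd q.snd).symm
  smul_mem' := by
    intro c p hp
    exact (IsWeakGrad.smul c hp).congr
      (Lp.coeFn_smul c p.fst).symm (Lp.coeFn_smul c p.snd).symm

/-- `𝕍 = H¹(D)`, with the norm `(‖f‖²_{L²} + ‖∇f‖²_{L²})^{1/2}`. -/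
abbrev H1 {d : ℕ} (D : Set (Sp d)) : Type := ↥(H1Submodule D)

/-- The underlying function of an element of `H¹(D)` (defined a.e. on `D`). -/
noncomputable def H1.val {d : ℕ} {D : Set (Sp d)} (u : H1 D) : Sp d → ℝ :=
  (u : L2Pair D).fst

/-- The weak gradient of an element of `H¹(D)` (defined a.e. on `D`). -/
noncomputable def H1.grad {d : ℕ} {D : Set (Sp d)} (u : H1 D) : Sp d → Sp d :=
  (u : L2Pair D).snd

theorem H1.isWeakGrad {d : ℕ} {D : Set (Sp d)} (u : H1 D) : IsWeakGrad D u.val u.grad :=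
  u.2

/-- An element of `H¹(D)` is determined by its underlying function. -/
theorem H1.ext_val {d : ℕ} {D : Set (Sp d)} (hD : IsOpen D) {u w : H1 D}
    (h : u.val =ᵐ[volume.restrict D] w.val) : u = w := by
  have h2 : u.grad =ᵐ[volume.restrict D] w.grad :=
    IsWeakGrad.unique hD (Lp.memLp _) (Lp.memLp _)
      (u.isWeakGrad.congr h (Filter.EventuallyEq.refl _ _)) w.isWeakGrad
  apply Subtype.ext
  apply WithLp.ofLp_injective
  exact Prod.ext (Lp.ext h) (Lp.ext h2)

/-- Every `f ∈ L²(D)` with weak gradient `g ∈ L²(D; ℝ^d)` gives an element of `H¹(D)`. -/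
theorem H1.exists_of_memLp {d : ℕ} {D : Set (Sp d)} {f : Sp d → ℝ} {g : Sp d → Sp d}
    (hf : MemLp f 2 (volume.restrict D)) (hg : MemLp g 2 (volume.restrict D))
    (h : IsWeakGrad D f g) :
    ∃ u : H1 D, u.val =ᵐ[volume.restrict D] f ∧ u.grad =ᵐ[volume.restrict D] g :=
  ⟨⟨WithLp.toLp 2 (hf.toLp f, hg.toLp g), h.congr hf.coeFn_toLp.symm hg.coeFn_toLp.symm⟩,
    hf.coeFn_toLp, hg.coeFn_toLp⟩

/-- `H¹(D) ∩ L^∞(D)`, realised as the pairs `(v, w) ∈ H¹(D) × L^∞(D)` with `v = w` a.e., inside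
the product with the norm `‖v‖_{H¹} + ‖w‖_{L^∞}`. -/
def H1LinfSubmodule {d : ℕ} (D : Set (Sp d)) :
    Submodule ℝ (WithLp 1 (H1 D × Lp ℝ ∞ (volume.restrict D))) where
  carrier := {p | p.fst.val =ᵐ[volume.restrict D] p.snd}
  zero_mem' :=
    (Lp.coeFn_zero ℝ 2 (volume.restrict D)).trans (Lp.coeFn_zero ℝ ∞ (volume.restrict D)).symm
  add_mem' := by
    intro p q hp hq
    exact ((Lp.coeFn_add (p.fst : L2Pair D).fst (q.fst : L2Pair D).fst).trans
      (Filter.EventuallyEq.add hp hq)).trans (Lp.coeFn_add p.snd q.snd).symm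
  smul_mem' := by
    intro c p hp
    have hp' : p.fst.val =ᵐ[volume.restrict D] p.snd := hp
    exact ((Lp.coeFn_smul c (p.fst : L2Pair D).fst).trans
      (Filter.EventuallyEq.const_smul hp' c)).trans (Lp.coeFn_smul c p.snd).symm

/-- `𝕍_T = H¹(D) ∩ L^∞(D)`, with the norm `‖v‖_{H¹} + ‖v‖_{L^∞}`. -/
abbrev H1Linf {d : ℕ} (D : Set (Sp d)) : Type := ↥(H1LinfSubmodule D)

/-- The inclusion `H¹(D) ∩ L^∞(D) → H¹(D)`. -/
def H1Linf.toH1 {d : ℕ} {D : Set (Sp d)} (v : H1Linf D) : H1 D :=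
  (v : WithLp 1 (H1 D × Lp ℝ ∞ (volume.restrict D))).fst

/-- The norm of `H¹(D)`. -/
theorem H1.norm_eq {d : ℕ} {D : Set (Sp d)} (u : H1 D) :
    ‖u‖ = √((eLpNorm u.val 2 (volume.restrict D)).toReal ^ 2
      + (eLpNorm u.grad 2 (volume.restrict D)).toReal ^ 2) :=
  WithLp.prod_norm_eq_of_L2 (u : L2Pair D)

/-- The norm of `H¹(D) ∩ L^∞(D)`. -/
theorem H1Linf.norm_eq {d : ℕ} {D : Set (Sp d)} (v : H1Linf D) :
    ‖v‖ = ‖v.toH1‖ + (eLpNorm v.toH1.val ∞ (volume.restrict D)).toReal := by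
  have h : eLpNorm v.toH1.val ∞ (volume.restrict D) = eLpNorm
      ((v : WithLp 1 (H1 D × Lp ℝ ∞ (volume.restrict D))).snd) ∞ (volume.restrict D) :=
    eLpNorm_congr_ae v.2
  rw [h]
  exact WithLp.prod_norm_eq_of_L1 (v : WithLp 1 (H1 D × Lp ℝ ∞ (volume.restrict D)))

/-- Every essentially bounded element of `H¹(D)` belongs to `H¹(D) ∩ L^∞(D)`. -/
theorem H1Linf.exists_of_memLp {d : ℕ} {D : Set (Sp d)} {u : H1 D}
    (h : MemLp u.val ∞ (volume.restrict D)) : ∃ v : H1Linf D, v.toH1 = u :=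
  ⟨⟨WithLp.toLp 1 (u, h.toLp u.val), h.coeFn_toLp.symm⟩, rfl⟩

/-- The fixed model parameters: exponent `α`, strain-limiting parameter `β`, bulk regularization
`κ`, length scale `ε` and weight `λ_c` of the surface energy. -/
structure Params where
  α : ℝ
  β : ℝ
  κ : ℝ
  ε : ℝ
  lamc : ℝ

/-- The normalization constant `c_w` of the damage field energy. -/
noncomputable def cw : ℝ := 8 / 3

/-- `ρ = λ_c ε / c_w`. -/
noncomputable def Params.ρ (P : Params) : ℝ := P.lamc * P.ε / cw

/-- `δ = λ_c / (c_w ε)`. -/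
noncomputable def Params.δ (P : Params) : ℝ := P.lamc / (cw * P.ε)

/-- The pointwise stress variable `T = √((1-κ) v² + κ) ∇u`, for `v = s` and `∇u = p`. -/
noncomputable def Params.T {d : ℕ} (P : Params) (p : Sp d) (s : ℝ) : Sp d :=
  √((1 - P.κ) * s ^ 2 + P.κ) • p

/-- `1 + β^α |T|^{2α}`, for `v = s` and `∇u = p`. -/
noncomputable def Params.den {d : ℕ} (P : Params) (p : Sp d) (s : ℝ) : ℝ :=
  1 + P.β ^ P.α * ‖P.T p s‖ ^ (2 * P.α)

/-- The integrand of `J(u, v)`. -/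
noncomputable def Params.density {d : ℕ} {D : Set (Sp d)} (P : Params) (u v : H1 D)
    (x : Sp d) : ℝ :=
  ‖P.T (u.grad x) (v.val x)‖ ^ 2 / (2 * P.den (u.grad x) (v.val x) ^ (1 / P.α))
    + P.ρ * ‖v.grad x‖ ^ 2 + P.δ * (1 - v.val x)

/-- The regularized energy `J(u, v)`. -/
noncomputable def Params.J {d : ℕ} {D : Set (Sp d)} (P : Params) (u v : H1 D) : ℝ :=
  ∫ x in D, P.density u v x

/-- The integrand of `A(v; u, ψ)`. -/
noncomputable def Params.densityA {d : ℕ} {D : Set (Sp d)} (P : Params) (v u ψ : H1 D)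
    (x : Sp d) : ℝ :=
  ((1 - P.κ) * v.val x ^ 2 + P.κ) / P.den (u.grad x) (v.val x) ^ (1 / P.α + 1)
    * inner ℝ (u.grad x) (ψ.grad x)

/-- `A(v; u, ψ)`, the part of the derivative of `J` in the direction `ψ` of `u`. -/
noncomputable def Params.A {d : ℕ} {D : Set (Sp d)} (P : Params) (v u ψ : H1 D) : ℝ :=
  ∫ x in D, P.densityA v u ψ x

/-- The integrand of `B(u; v, φ)`. -/
noncomputable def Params.densityB {d : ℕ} {D : Set (Sp d)} (P : Params) (u v φ : H1 D)
    (x : Sp d) : ℝ :=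
  2 * P.ρ * inner ℝ (v.grad x) (φ.grad x) - P.δ * φ.val x
    + (1 - P.κ) * ‖u.grad x‖ ^ 2 / P.den (u.grad x) (v.val x) ^ (1 / P.α + 1)
      * v.val x * φ.val x

/-- `B(u; v, φ)`, the part of the derivative of `J` in the direction `φ` of `v`. -/
noncomputable def Params.B {d : ℕ} {D : Set (Sp d)} (P : Params) (u v φ : H1 D) : ℝ :=
  ∫ x in D, P.densityB u v φ x

end PhaseField

/-!
The energy splits into a bulk part, depending on `(∇u, v)`, a quadratic gradient term and an affine
term; only the bulk part is nonlinear in an essential way. It equals `Φ(|T|²)` for the scalar profile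
`Φ(t) = t / (2 (1 + β^α t^α)^{1/α})`, whose derivative `Φ'(t) = (1 + β^α t^α)^{-(1/α+1)} / 2` is
positive, bounded by `1/2` and nonincreasing on `t > 0`. Hence `Φ` is concave, and
`|Φ(t') - Φ(t) - Φ'(t) (t' - t)| ≤ |Φ'(t') - Φ'(t)| |t' - t|`
(`abs_taylor_remainder_le_of_antitoneOn`): the remainder only involves the increment of `Φ'` between
the endpoints. Since `|T|² = ((1-κ) v² + κ) |∇u|²` is a polynomial in `v` and `∇u`, and since `v`
varies in `L^∞`, its increment is explicit, and the pointwise remainder of the bulk density along an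
increment `(ψ, φ)` is at most a constant times
`|∇ψ|² + ‖φ‖² |∇u|² + θ |∇u| |∇ψ| + ‖φ‖ θ |∇u|²`,
where `θ ≤ 1` is the increment of the weight `2 Φ'(|T|²)` (`Params.abs_bulk_remainder_le`).

Integration and the Cauchy-Schwarz inequality bound the remainder of `J` by
`‖h‖ (C ‖h‖ + C (√W + W))` with `h = (ψ, φ)` and `W = ∫ θ |∇u|²` (`Params.abs_J_remainder_le`).
Finally `W → 0` as `h → 0`: along a subsequence `∇u` and `v` converge almost everywhere, the weight
is continuous and bounded, and `|∇u|²` is integrable, so dominated convergence applies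
(`tendsto_integral_abs_sub_mul`). The candidate derivative is bounded because its coefficients lie
in `L²`, `L²`, `L²` and `L¹`, paired with `∇ψ`, `∇φ` and `φ` in `L²` and `φ` in `L^∞` respectively
(`Params.exists_clm_eq_A_add_B`).
-/

namespace PhaseField

open Filter Topology

/-! ### The scalar energy profile -/

/-- If `f'` is antitone, the first-order Taylor remainder of `f` is controlled by the increment of
`f'` between the two endpoints alone, with no supremum over intermediate points. -/
theorem abs_taylor_remainder_le_of_antitoneOn {f f' : ℝ → ℝ} (hf : ContinuousOn f (Set.Ici 0))
    (hd : ∀ t, 0 < t → HasDerivAt f (f' t) t) (ha : AntitoneOn f' (Set.Ici 0)) {s t : ℝ}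
    (hs : 0 ≤ s) (ht : 0 ≤ t) :
    |f t - f s - f' s * (t - s)| ≤ |f' t - f' s| * |t - s| := by
  have slope : ∀ a b : ℝ, 0 ≤ a → a < b →
      f' b * (b - a) ≤ f b - f a ∧ f b - f a ≤ f' a * (b - a) := by
    intro a b ha0 hab
    obtain ⟨c, hc, e⟩ := exists_hasDerivAt_eq_slope f f' hab
      (hf.mono fun x hx => ha0.trans hx.1) fun x hx => hd x (ha0.trans_lt hx.1)
    have hba : 0 < b - a := sub_pos.2 hab
    have hc0 : (0 : ℝ) ≤ c := ha0.trans hc.1.le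
    have e' : f b - f a = f' c * (b - a) := by rw [e]; field_simp
    rw [e']
    exact ⟨mul_le_mul_of_nonneg_right (ha hc0 (ha0.trans hab.le) hc.2.le) hba.le,
      mul_le_mul_of_nonneg_right (ha ha0 hc0 hc.1.le) hba.le⟩
  rw [← abs_mul]
  rcases lt_trichotomy s t with h | rfl | h
  · obtain ⟨h1, h2⟩ := slope s t hs h
    rw [abs_of_nonpos (by linarith), abs_of_nonpos (by nlinarith)]
    nlinarith
  · simp
  · obtain ⟨h1, h2⟩ := slope t s ht h
    rw [abs_of_nonpos (by nlinarith), abs_of_nonpos (by nlinarith)]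
    nlinarith

/-- The scalar profile `t ↦ t / (2 (1 + c t^α)^{1/α})`, evaluated at `t = |T|²` in the energy. -/
noncomputable def profile (α c t : ℝ) : ℝ := t / (2 * (1 + c * t ^ α) ^ (1 / α))

/-- Twice the derivative of `profile`. -/
noncomputable def profileSlope (α c t : ℝ) : ℝ := 1 / (1 + c * t ^ α) ^ (1 / α + 1)

theorem one_le_profile_base {c t : ℝ} (α : ℝ) (hc : 0 ≤ c) (ht : 0 ≤ t) :
    1 ≤ 1 + c * t ^ α := by
  have := mul_nonneg hc (Real.rpow_nonneg ht α)
  linarith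

theorem profile_nonneg {c t : ℝ} (α : ℝ) (hc : 0 ≤ c) (ht : 0 ≤ t) : 0 ≤ profile α c t := by
  have := one_le_profile_base α hc ht
  unfold profile
  positivity

section profile

variable {α c : ℝ} (hα : 0 < α) (hc : 0 ≤ c)
include hα hc

theorem continuousOn_profile : ContinuousOn (profile α c) (Set.Ici 0) := by
  have h1 : ContinuousOn (fun t : ℝ => 1 + c * t ^ α) (Set.Ici 0) :=
    (continuous_const.add (continuous_const.mul
      (Real.continuous_rpow_const hα.le))).continuousOn
  refine continuousOn_id.div (continuousOn_const.mul (h1.rpow_const fun t _ =>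
    Or.inr (by positivity))) fun t ht => ?_
  have := one_le_profile_base α hc ht
  positivity

theorem hasDerivAt_profile {t : ℝ} (ht : 0 < t) :
    HasDerivAt (profile α c) (profileSlope α c t / 2) t := by
  have hD : 0 < 1 + c * t ^ α := one_pos.trans_le (one_le_profile_base α hc ht.le)
  have h1 : HasDerivAt (fun t : ℝ => 1 + c * t ^ α) (c * (α * t ^ (α - 1))) t :=
    ((Real.hasDerivAt_rpow_const (Or.inl ht.ne')).const_mul c).const_add 1
  have h2 := (hasDerivAt_id t).div ((h1.rpow_const (p := 1 / α) (Or.inl hD.ne')).const_mul 2)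
    (by positivity)
  refine h2.congr_deriv ?_
  have e1 : t ^ α = t ^ (α - 1) * t := by
    rw [← Real.rpow_add_one ht.ne', sub_add_cancel]
  have e2 : (1 + c * t ^ α) ^ (1 / α) = (1 + c * t ^ α) ^ (1 / α - 1) * (1 + c * t ^ α) := by
    rw [← Real.rpow_add_one hD.ne', sub_add_cancel]
  have e3 : (1 + c * t ^ α) ^ (1 / α + 1) = (1 + c * t ^ α) ^ (1 / α) * (1 + c * t ^ α) :=
    Real.rpow_add_one hD.ne' _
  have hX : 0 < (1 + c * t ^ α) ^ (1 / α - 1) := by positivity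
  simp only [profileSlope, id]
  rw [e3, e2]
  generalize (1 + c * t ^ α) ^ (1 / α - 1) = X at *
  rw [e1] at hD ⊢
  field_simp
  ring

theorem antitoneOn_profileSlope : AntitoneOn (profileSlope α c) (Set.Ici 0) := by
  intro s hs t ht hst
  have h := one_le_profile_base α hc hs
  have h0 : (0 : ℝ) ≤ s := hs
  unfold profileSlope
  gcongr

theorem profile_le {t : ℝ} (ht : 0 ≤ t) : profile α c t ≤ t := by
  have := one_le_profile_base α hc ht
  unfold profile
  have h2 : 1 ≤ (1 + c * t ^ α) ^ (1 / α) := Real.one_le_rpow this (by positivity)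
  exact div_le_self ht (by linarith)

theorem abs_profile_remainder_le {s t : ℝ} (hs : 0 ≤ s) (ht : 0 ≤ t) :
    |profile α c t - profile α c s - profileSlope α c s / 2 * (t - s)|
      ≤ |profileSlope α c t - profileSlope α c s| / 2 * |t - s| := by
  have h := abs_taylor_remainder_le_of_antitoneOn (f := profile α c)
    (f' := fun t => profileSlope α c t / 2) (continuousOn_profile hα hc)
    (fun t ht => hasDerivAt_profile hα hc ht)
    (fun a ha b hb hab => div_le_div_of_nonneg_right
      (antitoneOn_profileSlope hα hc ha hb hab) zero_le_two) hs ht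
  rwa [← sub_div, abs_div, abs_two] at h

end profile

/-! ### The energy density as a function of `∇u` and `v` -/

namespace Params

variable {d : ℕ} (P : Params)

/-- The degradation function `(1-κ) s² + κ`. -/
noncomputable def deg (s : ℝ) : ℝ := (1 - P.κ) * s ^ 2 + P.κ

/-- The coefficient `(1 + β^α |T|^{2α})^{-(1/α+1)}` appearing in the derivative of the energy. -/
noncomputable def weight (p : Sp d) (s : ℝ) : ℝ := 1 / P.den p s ^ (1 / P.α + 1)

/-- The strain-limiting part `|T|² / (2 (1 + β^α |T|^{2α})^{1/α})` of the energy density. -/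
noncomputable def bulk (p : Sp d) (s : ℝ) : ℝ :=
  ‖P.T p s‖ ^ 2 / (2 * P.den p s ^ (1 / P.α))

theorem continuous_T : Continuous fun z : Sp d × ℝ => P.T z.1 z.2 := by
  unfold T
  fun_prop

variable {P}

section

variable (hκ : 0 < P.κ) (hκ1 : P.κ < 1)
include hκ hκ1

theorem deg_pos (s : ℝ) : 0 < P.deg s := by
  have := mul_nonneg (sub_pos.2 hκ1).le (sq_nonneg s)
  unfold deg
  linarith

theorem deg_le {s N : ℝ} (hs : |s| ≤ N) : P.deg s ≤ N ^ 2 + 1 := by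
  have h : s ^ 2 ≤ N ^ 2 := sq_le_sq' (abs_le.1 hs).1 (abs_le.1 hs).2
  unfold deg
  nlinarith [sq_nonneg s]

theorem norm_T_sq (p : Sp d) (s : ℝ) : ‖P.T p s‖ ^ 2 = P.deg s * ‖p‖ ^ 2 := by
  have h := (deg_pos hκ hκ1 s).le
  unfold deg at h
  rw [T, norm_smul, mul_pow, Real.norm_eq_abs, sq_abs, Real.sq_sqrt h, deg]

theorem den_eq (p : Sp d) (s : ℝ) :
    P.den p s = 1 + P.β ^ P.α * (P.deg s * ‖p‖ ^ 2) ^ P.α := by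
  rw [den, ← norm_T_sq hκ hκ1, ← Real.rpow_natCast, ← Real.rpow_mul (norm_nonneg _)]
  norm_num

theorem bulk_eq (p : Sp d) (s : ℝ) :
    P.bulk p s = profile P.α (P.β ^ P.α) (P.deg s * ‖p‖ ^ 2) := by
  rw [bulk, norm_T_sq hκ hκ1, den_eq hκ hκ1, profile]

theorem weight_eq (p : Sp d) (s : ℝ) :
    P.weight p s = profileSlope P.α (P.β ^ P.α) (P.deg s * ‖p‖ ^ 2) := by
  rw [weight, den_eq hκ hκ1, profileSlope]

theorem stress_sq_nonneg (p : Sp d) (s : ℝ) : 0 ≤ P.deg s * ‖p‖ ^ 2 :=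
  mul_nonneg (deg_pos hκ hκ1 s).le (sq_nonneg _)

end

theorem one_le_den (hβ : 0 ≤ P.β) (p : Sp d) (s : ℝ) : 1 ≤ P.den p s := by
  have : 0 ≤ P.β ^ P.α * ‖P.T p s‖ ^ (2 * P.α) := by positivity
  unfold den
  linarith

theorem weight_nonneg (hβ : 0 ≤ P.β) (p : Sp d) (s : ℝ) : 0 ≤ P.weight p s := by
  have := one_le_den hβ p s
  unfold weight
  positivity

theorem continuous_den (hα : 0 < P.α) : Continuous fun z : Sp d × ℝ => P.den z.1 z.2 :=
  continuous_const.add (continuous_const.mul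
    (P.continuous_T.norm.rpow_const fun _ => Or.inr (by positivity)))

section

variable (hα : 0 < P.α) (hβ : 0 ≤ P.β)
include hα hβ

theorem continuous_weight : Continuous fun z : Sp d × ℝ => P.weight z.1 z.2 := by
  refine continuous_const.div ((continuous_den hα).rpow_const fun _ =>
    Or.inr (by positivity)) fun z => ?_
  have := one_le_den hβ z.1 z.2
  positivity

theorem continuous_bulk : Continuous fun z : Sp d × ℝ => P.bulk z.1 z.2 := by
  refine (P.continuous_T.norm.pow 2).div (continuous_const.mul
    ((continuous_den hα).rpow_const fun _ => Or.inr (by positivity))) fun z => ?_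
  have := one_le_den hβ z.1 z.2
  positivity

theorem weight_le_one (p : Sp d) (s : ℝ) : P.weight p s ≤ 1 := by
  have := one_le_den hβ p s
  rw [weight, div_le_one (by positivity)]
  exact Real.one_le_rpow this (by positivity)

theorem abs_weight_sub_le_one (p q : Sp d) (s t : ℝ) : |P.weight p s - P.weight q t| ≤ 1 := by
  rw [abs_le]
  constructor <;> linarith [weight_nonneg hβ p s, weight_nonneg hβ q t,
    weight_le_one hα hβ p s, weight_le_one hα hβ q t]

variable (hκ : 0 < P.κ) (hκ1 : P.κ < 1)
include hκ hκ1

theorem abs_bulk_le (p : Sp d) {s N : ℝ} (hs : |s| ≤ N) :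
    |P.bulk p s| ≤ (N ^ 2 + 1) * ‖p‖ ^ 2 := by
  have h0 := stress_sq_nonneg hκ hκ1 p s
  have hc : 0 ≤ P.β ^ P.α := by positivity
  rw [bulk_eq hκ hκ1, abs_of_nonneg (profile_nonneg _ hc h0)]
  exact (profile_le hα hc h0).trans
    (mul_le_mul_of_nonneg_right (deg_le hκ hκ1 hs) (sq_nonneg _))

/-- Pointwise first-order expansion of the bulk energy density. The remainder is quadratic in the
increments up to a term weighted by the increment of `weight`, which is bounded and tends to zero
with the increments. -/
theorem abs_bulk_remainder_le {p p' : Sp d} {s s' M R : ℝ} (hs : |s| ≤ M) (hr : |s' - s| ≤ R)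
    (hR : R ≤ 1) :
    |P.bulk p' s' - P.bulk p s - P.weight p s *
        (P.deg s * inner ℝ p (p' - p) + (1 - P.κ) * ‖p‖ ^ 2 * s * (s' - s))|
      ≤ 2 * ((M + 1) ^ 2 + 1) * (‖p' - p‖ ^ 2 + R ^ 2 * ‖p‖ ^ 2)
        + ((M + 1) ^ 2 + 1) * (|P.weight p' s' - P.weight p s| * ‖p‖ * ‖p' - p‖
          + R * (|P.weight p' s' - P.weight p s| * ‖p‖ ^ 2)) := by
  obtain ⟨q, rfl⟩ : ∃ q, p' = p + q := ⟨p' - p, by abel⟩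
  obtain ⟨r, rfl⟩ : ∃ r, s' = s + r := ⟨s' - s, by ring⟩
  simp only [add_sub_cancel_left] at hr ⊢
  have hw0 := weight_nonneg hβ p s
  have hw1 := weight_le_one hα hβ p s
  have hθ1 := abs_weight_sub_le_one hα hβ (p + q) p (s + r) s
  have main := abs_profile_remainder_le hα (by positivity : 0 ≤ P.β ^ P.α)
    (stress_sq_nonneg hκ hκ1 p s) (stress_sq_nonneg hκ hκ1 (p + q) (s + r))
  rw [← bulk_eq hκ hκ1, ← bulk_eq hκ hκ1, ← weight_eq hκ hκ1, ← weight_eq hκ hκ1] at main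
  set θ := |P.weight (p + q) (s + r) - P.weight p s|
  have hθ0 : 0 ≤ θ := abs_nonneg _
  set w := P.weight p s
  set a := ‖p‖ with ha
  set b := ‖q‖ with hb
  have ha0 : 0 ≤ a := norm_nonneg _
  have hb0 : 0 ≤ b := norm_nonneg _
  have hR0 : 0 ≤ R := (abs_nonneg r).trans hr
  have hM0 : 0 ≤ M := (abs_nonneg s).trans hs
  have hin : |inner ℝ p q| ≤ a * b := abs_real_inner_le_norm p q
  have hnorm : ‖p + q‖ ^ 2 = a ^ 2 + 2 * inner ℝ p q + b ^ 2 := norm_add_sq_real p q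
  set G := (M + 1) ^ 2 + 1
  have hG0 : 0 ≤ G := by positivity
  have hg0 : 0 ≤ P.deg (s + r) := (deg_pos hκ hκ1 _).le
  have hgG : P.deg (s + r) ≤ G :=
    deg_le hκ hκ1 ((abs_add_le s r).trans (add_le_add hs (hr.trans hR)))
  have hgd : P.deg (s + r) - P.deg s = (1 - P.κ) * (2 * s * r + r ^ 2) := by
    unfold deg; ring
  have hk0 : 0 ≤ 1 - P.κ := by linarith
  have hgd' : |P.deg (s + r) - P.deg s| ≤ G * R := by
    rw [hgd, abs_mul, abs_of_nonneg hk0]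
    have h1 : |2 * s * r + r ^ 2| ≤ 2 * M * R + R := by
      have e : |2 * s * r + r ^ 2| ≤ 2 * |s| * |r| + |r| * |r| := by
        refine (abs_add_le _ _).trans (le_of_eq ?_)
        rw [abs_mul, abs_mul, abs_two, abs_pow]
        ring
      have e1 : |s| * |r| ≤ M * R := mul_le_mul hs hr (abs_nonneg _) hM0
      have e2 : |r| * |r| ≤ R * 1 := mul_le_mul hr (hr.trans hR) (abs_nonneg _) hR0
      linarith
    have h2 : (1 - P.κ) * |2 * s * r + r ^ 2| ≤ 1 * |2 * s * r + r ^ 2| :=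
      mul_le_mul_of_nonneg_right (by linarith) (abs_nonneg _)
    have h3 : 0 ≤ (M ^ 2 + 1) * R := by positivity
    have h4 : G * R = (M ^ 2 + 1) * R + (2 * M * R + R) := by simp only [G]; ring
    linarith
  -- the increment of `|T|²`
  set Δ := P.deg (s + r) * ‖p + q‖ ^ 2 - P.deg s * a ^ 2 with hΔ
  have hΔ1 : Δ = P.deg (s + r) * (2 * inner ℝ p q + b ^ 2)
      + (P.deg (s + r) - P.deg s) * a ^ 2 := by
    rw [hΔ, hnorm]; ring
  have hΔle : |Δ| ≤ G * (2 * (a * b) + b ^ 2 + R * a ^ 2) := by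
    have h1 : |2 * inner ℝ p q + b ^ 2| ≤ 2 * (a * b) + b ^ 2 := by
      refine (abs_add_le _ _).trans ?_
      rw [abs_mul, abs_two, abs_of_nonneg (sq_nonneg b)]
      linarith
    rw [hΔ1]
    refine (abs_add_le _ _).trans ?_
    rw [abs_mul, abs_mul, abs_of_nonneg hg0, abs_of_nonneg (sq_nonneg a)]
    have h2 := mul_le_mul hgG h1 (abs_nonneg _) hG0
    have h3 := mul_le_mul_of_nonneg_right hgd' (sq_nonneg a)
    linarith
  have hr2 : r ^ 2 ≤ R ^ 2 := sq_le_sq' (abs_le.1 hr).1 (abs_le.1 hr).2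
  -- the second-order part of the increment of `|T|²`
  have hΔ2 : w / 2 * Δ - w * (P.deg s * inner ℝ p q + (1 - P.κ) * a ^ 2 * s * r)
      = w * ((P.deg (s + r) - P.deg s) * inner ℝ p q + P.deg (s + r) * b ^ 2 / 2
        + (1 - P.κ) * r ^ 2 * a ^ 2 / 2) := by
    linear_combination w / 2 * hΔ1 + w * a ^ 2 / 2 * hgd
  -- Young's inequality absorbs the mixed term `R |p| |q|`
  have hY : R * (a * b) ≤ (b ^ 2 + R ^ 2 * a ^ 2) / 2 := by
    nlinarith [sq_nonneg (b - R * a)]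
  have hquad : |(P.deg (s + r) - P.deg s) * inner ℝ p q + P.deg (s + r) * b ^ 2 / 2
        + (1 - P.κ) * r ^ 2 * a ^ 2 / 2| ≤ G * (b ^ 2 + R ^ 2 * a ^ 2) := by
    have h1 : |(P.deg (s + r) - P.deg s) * inner ℝ p q| ≤ G * R * (a * b) := by
      rw [abs_mul]
      exact mul_le_mul hgd' hin (abs_nonneg _) (by positivity)
    have h2 : P.deg (s + r) * b ^ 2 ≤ G * b ^ 2 := mul_le_mul_of_nonneg_right hgG (sq_nonneg _)
    have h3 : (1 - P.κ) * r ^ 2 * a ^ 2 ≤ G * (R ^ 2 * a ^ 2) := by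
      rw [mul_assoc]
      have hG1 : 1 - P.κ ≤ G := by
        have : 1 ≤ G := by simp only [G]; linarith [sq_nonneg (M + 1)]
        linarith
      exact mul_le_mul hG1 (mul_le_mul_of_nonneg_right hr2 (sq_nonneg _)) (by positivity) hG0
    have h4 : 0 ≤ P.deg (s + r) * b ^ 2 / 2 := by positivity
    have h5 : 0 ≤ (1 - P.κ) * r ^ 2 * a ^ 2 / 2 := by positivity
    have h6 := mul_le_mul_of_nonneg_left hY hG0
    refine (abs_add_le _ _).trans ((add_le_add (abs_add_le _ _) le_rfl).trans ?_)
    rw [abs_of_nonneg h4, abs_of_nonneg h5]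
    linarith
  have hfin1 : |w / 2 * Δ - w * (P.deg s * inner ℝ p q + (1 - P.κ) * a ^ 2 * s * r)|
      ≤ G * (b ^ 2 + R ^ 2 * a ^ 2) := by
    rw [hΔ2, abs_mul, abs_of_nonneg hw0]
    exact (mul_le_of_le_one_left (abs_nonneg _) hw1).trans hquad
  have hfin2 : θ / 2 * |Δ| ≤ G * (θ * a * b + R * (θ * a ^ 2)) + G * b ^ 2 := by
    have h1 := mul_le_mul_of_nonneg_left hΔle (by positivity : 0 ≤ θ / 2)
    have h2 : θ * (G * b ^ 2) ≤ G * b ^ 2 := mul_le_of_le_one_left (by positivity) hθ1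
    have h3 : 0 ≤ G * (R * (θ * a ^ 2)) := by positivity
    have h4 : 0 ≤ G * b ^ 2 := by positivity
    linarith
  have htri : |P.bulk (p + q) (s + r) - P.bulk p s
        - w * (P.deg s * inner ℝ p q + (1 - P.κ) * a ^ 2 * s * r)|
      ≤ |P.bulk (p + q) (s + r) - P.bulk p s - w / 2 * Δ|
        + |w / 2 * Δ - w * (P.deg s * inner ℝ p q + (1 - P.κ) * a ^ 2 * s * r)| := by
    refine le_trans (le_of_eq ?_) (abs_add_le _ _)
    congr 1
    ring
  have h0 : 0 ≤ G * (R ^ 2 * a ^ 2) := by positivity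
  linarith

end

end Params


/-! ### The spaces `H¹(D)` and `H¹(D) ∩ L^∞(D)` -/

section spaces

variable {d : ℕ} {D : Set (Sp d)}

/-- The weak gradient as a bounded operator `H¹(D) → L²(D; ℝ^d)`. -/
noncomputable def H1.gradL (D : Set (Sp d)) : H1 D →L[ℝ] Lp (Sp d) 2 (volume.restrict D) :=
  (WithLp.sndL 2 ℝ _ _).comp (H1Submodule D).subtypeL

/-- The inclusion `H¹(D) → L²(D)` as a bounded operator. -/
noncomputable def H1.valL (D : Set (Sp d)) : H1 D →L[ℝ] Lp ℝ 2 (volume.restrict D) :=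
  (WithLp.fstL 2 ℝ _ _).comp (H1Submodule D).subtypeL

/-- The inclusion `H¹(D) ∩ L^∞(D) → H¹(D)` as a bounded operator. -/
noncomputable def H1Linf.toH1L (D : Set (Sp d)) : H1Linf D →L[ℝ] H1 D :=
  (WithLp.fstL 1 ℝ _ _).comp (H1LinfSubmodule D).subtypeL

/-- The inclusion `H¹(D) ∩ L^∞(D) → L^∞(D)` as a bounded operator. -/
noncomputable def H1Linf.linfL (D : Set (Sp d)) : H1Linf D →L[ℝ] Lp ℝ ∞ (volume.restrict D) :=
  (WithLp.sndL 1 ℝ _ _).comp (H1LinfSubmodule D).subtypeL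

theorem H1.gradL_coe (u : H1 D) : ⇑(H1.gradL D u) = u.grad := rfl

theorem H1.valL_coe (u : H1 D) : ⇑(H1.valL D u) = u.val := rfl

theorem H1Linf.continuous_toH1 : Continuous (H1Linf.toH1 : H1Linf D → H1 D) :=
  (H1Linf.toH1L D).continuous

theorem H1Linf.linfL_ae_eq (v : H1Linf D) :
    H1Linf.linfL D v =ᵐ[volume.restrict D] v.toH1.val :=
  Filter.EventuallyEq.symm v.2

theorem H1.memLp_grad (u : H1 D) : MemLp u.grad 2 (volume.restrict D) := Lp.memLp _

theorem H1.memLp_val (u : H1 D) : MemLp u.val 2 (volume.restrict D) := Lp.memLp _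

theorem H1Linf.memLp_top (v : H1Linf D) : MemLp v.toH1.val ∞ (volume.restrict D) :=
  (memLp_congr_ae v.linfL_ae_eq).1 (Lp.memLp _)

theorem H1.grad_sub (u w : H1 D) :
    (u - w).grad =ᵐ[volume.restrict D] fun x => u.grad x - w.grad x := by
  rw [← H1.gradL_coe, map_sub]
  exact Lp.coeFn_sub _ _

theorem H1.val_sub (u w : H1 D) :
    (u - w).val =ᵐ[volume.restrict D] fun x => u.val x - w.val x := by
  rw [← H1.valL_coe, map_sub]
  exact Lp.coeFn_sub _ _

theorem H1.integrable_norm_grad_sq (u : H1 D) :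
    Integrable (fun x => ‖u.grad x‖ ^ 2) (volume.restrict D) :=
  (memLp_two_iff_integrable_sq_norm u.memLp_grad.1).1 u.memLp_grad

theorem integrable_inner_of_memLp_two {f g : Sp d → Sp d} (hf : MemLp f 2 (volume.restrict D))
    (hg : MemLp g 2 (volume.restrict D)) :
    Integrable (fun x => (inner ℝ (f x) (g x) : ℝ)) (volume.restrict D) := by
  refine (L2.integrable_inner (𝕜 := ℝ) (hf.toLp f) (hg.toLp g)).congr ?_
  filter_upwards [hf.coeFn_toLp, hg.coeFn_toLp] with x h1 h2
  rw [h1, h2]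

theorem H1.integral_norm_grad_sq_le (u : H1 D) : ∫ x in D, ‖u.grad x‖ ^ 2 ≤ ‖u‖ ^ 2 := by
  have h1 : ‖u‖ ^ 2 = ‖H1.valL D u‖ ^ 2 + ‖H1.gradL D u‖ ^ 2 :=
    WithLp.prod_norm_sq_eq_of_L2 (u : L2Pair D)
  have h2 : ‖H1.gradL D u‖ ^ 2 = ∫ x in D, ‖u.grad x‖ ^ 2 := by
    rw [← real_inner_self_eq_norm_sq, L2.inner_def]
    simp only [real_inner_self_eq_norm_sq, H1.gradL_coe]
  rw [h1, h2]
  exact le_add_of_nonneg_left (sq_nonneg _)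

theorem H1Linf.norm_toH1_le (v : H1Linf D) : ‖v.toH1‖ ≤ ‖v‖ := by
  rw [H1Linf.norm_eq]
  exact le_add_of_nonneg_right ENNReal.toReal_nonneg

theorem H1Linf.ae_abs_val_le (v : H1Linf D) :
    ∀ᵐ x ∂(volume.restrict D), |v.toH1.val x| ≤ ‖v‖ := by
  filter_upwards [enorm_ae_le_eLpNormEssSup v.toH1.val (volume.restrict D)] with x hx
  rw [H1Linf.norm_eq]
  have h := ENNReal.toReal_mono v.memLp_top.2.ne
    (by rwa [eLpNorm_exponent_top] : ‖v.toH1.val x‖ₑ ≤ _)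
  rw [toReal_enorm, Real.norm_eq_abs] at h
  linarith [norm_nonneg v.toH1]

theorem H1.aestronglyMeasurable_comp {k : Sp d → ℝ → ℝ}
    (hk : Continuous fun z : Sp d × ℝ => k z.1 z.2) (u v : H1 D) :
    AEStronglyMeasurable (fun x => k (u.grad x) (v.val x)) (volume.restrict D) :=
  hk.comp_aestronglyMeasurable (u.memLp_grad.1.prodMk v.memLp_val.1)

/-- Composition with a function that is continuous in `(∇u, v)` and bounded is continuous in
`(u, v) ∈ H¹ × H¹` for convergence in `L¹` with respect to an integrable density `g`. -/
theorem tendsto_integral_abs_sub_mul {k : Sp d → ℝ → ℝ}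
    (hk : Continuous fun z : Sp d × ℝ => k z.1 z.2)
    (hb : ∀ p q s t, |k p s - k q t| ≤ 1) {g : Sp d → ℝ}
    (hg : Integrable g (volume.restrict D)) (hg0 : ∀ x, 0 ≤ g x) (u v : H1 D) :
    Tendsto (fun z : H1 D × H1 D =>
        ∫ x in D, |k (z.1.grad x) (z.2.val x) - k (u.grad x) (v.val x)| * g x)
      (𝓝 (u, v)) (𝓝 0) := by
  refine tendsto_of_subseq_tendsto fun ns hns => ?_
  have h1 : Tendsto (fun n => H1.gradL D (ns n).1) atTop (𝓝 (H1.gradL D u)) :=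
    ((H1.gradL D).continuous.comp continuous_fst).continuousAt.tendsto.comp hns
  have h2 : Tendsto (fun n => H1.valL D (ns n).2) atTop (𝓝 (H1.valL D v)) :=
    ((H1.valL D).continuous.comp continuous_snd).continuousAt.tendsto.comp hns
  obtain ⟨a, ha, hae⟩ := (tendstoInMeasure_of_tendsto_Lp h1).exists_seq_tendsto_ae
  obtain ⟨b, hb', hbe⟩ :=
    (tendstoInMeasure_of_tendsto_Lp (h2.comp ha.tendsto_atTop)).exists_seq_tendsto_ae
  -- along `a ∘ b` both `∇u` and `v` converge almost everywhere
  refine ⟨a ∘ b, ?_⟩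
  have lim := tendsto_integral_of_dominated_convergence (μ := volume.restrict D)
    (F := fun n x => |k ((ns (a (b n))).1.grad x) ((ns (a (b n))).2.val x)
      - k (u.grad x) (v.val x)| * g x) (f := fun _ => 0) g
    (fun n => (((H1.aestronglyMeasurable_comp hk _ _).sub
      (H1.aestronglyMeasurable_comp hk _ _)).norm).mul hg.1) hg
    (fun n => Eventually.of_forall fun x => by
      rw [Real.norm_eq_abs, abs_mul, abs_abs, abs_of_nonneg (hg0 x)]
      exact mul_le_of_le_one_left (hg0 x) (hb _ _ _ _))
    (by
      filter_upwards [hae, hbe] with x hx1 hx2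
      have e1 := hx1.comp hb'.tendsto_atTop
      have e3 : Tendsto (fun n => k ((ns (a (b n))).1.grad x) ((ns (a (b n))).2.val x)) atTop
          (𝓝 (k (u.grad x) (v.val x))) :=
        (hk.tendsto (u.grad x, v.val x)).comp (e1.prodMk_nhds hx2)
      have e4 := ((e3.sub_const (k (u.grad x) (v.val x))).abs).mul_const (g x)
      simpa using e4)
  simpa using lim

/-- Integration against a square integrable field is a bounded functional of the gradient. -/
theorem H1.exists_clm_grad {f : Sp d → Sp d} (hf : MemLp f 2 (volume.restrict D)) :
    ∃ L : H1 D →L[ℝ] ℝ, ∀ ψ, L ψ = ∫ x in D, inner ℝ (f x) (ψ.grad x) := by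
  refine ⟨((innerSL ℝ).lpPairing (volume.restrict D) 2 2 (hf.toLp f)).comp (H1.gradL D),
    fun ψ => (ContinuousLinearMap.lpPairing_eq_integral _ _ _).trans (integral_congr_ae ?_)⟩
  filter_upwards [hf.coeFn_toLp] with x hx
  rw [hx]
  rfl

/-- Integration over a domain of finite measure is a bounded functional on `H¹(D)`. -/
theorem H1.exists_clm_val [IsFiniteMeasure (volume.restrict D)] :
    ∃ L : H1 D →L[ℝ] ℝ, ∀ ψ, L ψ = ∫ x in D, ψ.val x := by
  have h1 : MemLp (fun _ : Sp d => (1 : ℝ)) 2 (volume.restrict D) := memLp_const 1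
  refine ⟨((ContinuousLinearMap.mul ℝ ℝ).lpPairing (volume.restrict D) 2 2 (h1.toLp _)).comp
    (H1.valL D),
    fun ψ => (ContinuousLinearMap.lpPairing_eq_integral _ _ _).trans (integral_congr_ae ?_)⟩
  filter_upwards [h1.coeFn_toLp] with x hx
  rw [hx]
  exact one_mul _

/-- Integration against an integrable function is a bounded functional on `H¹(D) ∩ L^∞(D)`. -/
theorem H1Linf.exists_clm_val {f : Sp d → ℝ} (hf : Integrable f (volume.restrict D)) :
    ∃ L : H1Linf D →L[ℝ] ℝ, ∀ φ, L φ = ∫ x in D, f x * φ.toH1.val x := by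
  have h1 := memLp_one_iff_integrable.2 hf
  refine ⟨((ContinuousLinearMap.mul ℝ ℝ).lpPairing (volume.restrict D) 1 ∞ (h1.toLp f)).comp
    (H1Linf.linfL D),
    fun φ => (ContinuousLinearMap.lpPairing_eq_integral _ _ _).trans (integral_congr_ae ?_)⟩
  filter_upwards [h1.coeFn_toLp, φ.linfL_ae_eq] with x hx hx2
  rw [hx]
  exact congrArg _ hx2

end spaces

/-! ### Integrability and the candidate derivative -/

namespace Params

variable {d : ℕ} {D : Set (Sp d)} {P : Params}

section derivative

theorem density_eq (u v : H1 D) (x : Sp d) :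
    P.density u v x = P.bulk (u.grad x) (v.val x) + P.ρ * ‖v.grad x‖ ^ 2
      + P.δ * (1 - v.val x) := rfl

theorem densityA_eq (v u ψ : H1 D) (x : Sp d) :
    P.densityA v u ψ x = inner ℝ ((P.deg (v.val x) * P.weight (u.grad x) (v.val x)) • u.grad x)
      (ψ.grad x) := by
  rw [real_inner_smul_left, densityA, weight, deg, div_eq_mul_one_div]

theorem densityB_eq (u v φ : H1 D) (x : Sp d) :
    P.densityB u v φ x = 2 * P.ρ * inner ℝ (v.grad x) (φ.grad x) - P.δ * φ.val x
      + (1 - P.κ) * ‖u.grad x‖ ^ 2 * P.weight (u.grad x) (v.val x) * v.val x * φ.val x := by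
  rw [densityB, weight, div_eq_mul_one_div]

variable (hα : 0 < P.α) (hβ : 0 ≤ P.β)
include hα hβ

theorem aestronglyMeasurable_weight (u v : H1 D) :
    AEStronglyMeasurable (fun x => P.weight (u.grad x) (v.val x)) (volume.restrict D) :=
  H1.aestronglyMeasurable_comp (k := P.weight) (continuous_weight hα hβ) u v

/-- The coefficient of `φ` in the nonlinear part of `B(u; v, φ)` is integrable. -/
theorem integrable_coeffB (u : H1 D) (v : H1Linf D) :
    Integrable (fun x => (1 - P.κ) * ‖u.grad x‖ ^ 2 * P.weight (u.grad x) (v.toH1.val x)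
      * v.toH1.val x) (volume.restrict D) := by
  refine ((u.integrable_norm_grad_sq.const_mul (1 - P.κ)).mul_bdd (c := 1)
    (aestronglyMeasurable_weight hα hβ u v.toH1) (Eventually.of_forall fun x => ?_)).mul_bdd
    (c := ‖v‖) v.toH1.memLp_val.1 v.ae_abs_val_le
  rw [Real.norm_eq_abs, abs_of_nonneg (weight_nonneg hβ _ _)]
  exact weight_le_one hα hβ _ _

theorem integrable_densityB [IsFiniteMeasure (volume.restrict D)] (u : H1 D) (v φ : H1Linf D) :
    Integrable (P.densityB u v.toH1 φ.toH1) (volume.restrict D) := by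
  refine ((((integrable_inner_of_memLp_two v.toH1.memLp_grad φ.toH1.memLp_grad).const_mul
    (2 * P.ρ)).sub ((φ.toH1.memLp_val.integrable one_le_two).const_mul P.δ)).add
    ((integrable_coeffB hα hβ u v).mul_bdd (c := ‖φ‖) φ.toH1.memLp_val.1
      φ.ae_abs_val_le)).congr (Eventually.of_forall fun x => ?_)
  exact (densityB_eq u v.toH1 φ.toH1 x).symm

/-- `B(u; v, φ)` splits into three separately convergent integrals. -/
theorem B_eq [IsFiniteMeasure (volume.restrict D)] (u : H1 D) (v φ : H1Linf D) :
    P.B u v.toH1 φ.toH1 = 2 * P.ρ * (∫ x in D, inner ℝ (v.toH1.grad x) (φ.toH1.grad x))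
      - P.δ * (∫ x in D, φ.toH1.val x)
      + ∫ x in D, (1 - P.κ) * ‖u.grad x‖ ^ 2 * P.weight (u.grad x) (v.toH1.val x)
        * v.toH1.val x * φ.toH1.val x := by
  have i1 := (integrable_inner_of_memLp_two v.toH1.memLp_grad φ.toH1.memLp_grad).const_mul
    (2 * P.ρ)
  have i2 := (φ.toH1.memLp_val.integrable one_le_two).const_mul P.δ
  have i3 := (integrable_coeffB hα hβ u v).mul_bdd (c := ‖φ‖) φ.toH1.memLp_val.1 φ.ae_abs_val_le
  have i12 : Integrable (fun x => 2 * P.ρ * inner ℝ (v.toH1.grad x) (φ.toH1.grad x)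
      - P.δ * φ.toH1.val x) (volume.restrict D) := i1.sub i2
  rw [← integral_const_mul, ← integral_const_mul, ← integral_sub i1 i2, ← integral_add i12 i3]
  exact integral_congr_ae (Eventually.of_forall fun x => densityB_eq u v.toH1 φ.toH1 x)

variable (hκ : 0 < P.κ) (hκ1 : P.κ < 1)
include hκ hκ1

/-- The coefficient field of `∇ψ` in `A(v; u, ψ)` is square integrable. -/
theorem memLp_coeffA (u : H1 D) (v : H1Linf D) :
    MemLp (fun x => (P.deg (v.toH1.val x) * P.weight (u.grad x) (v.toH1.val x)) • u.grad x) 2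
      (volume.restrict D) := by
  have hdeg : Continuous P.deg := by unfold deg; fun_prop
  refine u.memLp_grad.of_le_mul (c := ‖v‖ ^ 2 + 1)
    (((hdeg.comp_aestronglyMeasurable v.toH1.memLp_val.1).mul
      (aestronglyMeasurable_weight hα hβ u v.toH1)).smul u.memLp_grad.1) ?_
  filter_upwards [v.ae_abs_val_le] with x hx
  have h0 := (deg_pos hκ hκ1 (v.toH1.val x)).le
  have h1 := weight_nonneg hβ (u.grad x) (v.toH1.val x)
  rw [norm_smul, Real.norm_eq_abs, abs_of_nonneg (mul_nonneg h0 h1)]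
  exact mul_le_mul_of_nonneg_right ((mul_le_of_le_one_right h0 (weight_le_one hα hβ _ _)).trans
    (deg_le hκ hκ1 hx)) (norm_nonneg _)

theorem integrable_densityA (u : H1 D) (v : H1Linf D) (ψ : H1 D) :
    Integrable (P.densityA v.toH1 u ψ) (volume.restrict D) := by
  refine (integrable_inner_of_memLp_two (memLp_coeffA hα hβ hκ hκ1 u v) ψ.memLp_grad).congr
    (Eventually.of_forall fun x => ?_)
  exact (densityA_eq v.toH1 u ψ x).symm

theorem integrable_density [IsFiniteMeasure (volume.restrict D)] (u : H1 D) (v : H1Linf D) :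
    Integrable (P.density u v.toH1) (volume.restrict D) := by
  have h1 : Integrable (fun x => P.bulk (u.grad x) (v.toH1.val x)) (volume.restrict D) := by
    refine (u.integrable_norm_grad_sq.const_mul (‖v‖ ^ 2 + 1)).mono'
      (H1.aestronglyMeasurable_comp (k := P.bulk) (continuous_bulk hα hβ) u v.toH1) ?_
    filter_upwards [v.ae_abs_val_le] with x hx
    exact abs_bulk_le hα hβ hκ hκ1 _ hx
  exact (h1.add (v.toH1.integrable_norm_grad_sq.const_mul P.ρ)).add
    (((integrable_const 1).sub (v.toH1.memLp_val.integrable (by norm_num))).const_mul P.δ)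

/-- The candidate derivative `(ψ, φ) ↦ A(v; u, ψ) + B(u; v, φ)` is a bounded linear functional. -/
theorem exists_clm_eq_A_add_B [IsFiniteMeasure (volume.restrict D)] (u : H1 D) (v : H1Linf D) :
    ∃ L : H1 D × H1Linf D →L[ℝ] ℝ, ∀ (ψ : H1 D) (φ : H1Linf D),
      L (ψ, φ) = P.A v.toH1 u ψ + P.B u v.toH1 φ.toH1 := by
  have hA := memLp_coeffA hα hβ hκ hκ1 u v
  have hB := integrable_coeffB hα hβ u v
  obtain ⟨LA, eA⟩ := H1.exists_clm_grad hA
  obtain ⟨LG, eG⟩ := H1.exists_clm_grad v.toH1.memLp_grad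
  obtain ⟨LV, eV⟩ := H1.exists_clm_val (D := D)
  obtain ⟨LB, eB⟩ := H1Linf.exists_clm_val hB
  refine ⟨LA.coprod (((2 * P.ρ) • LG - P.δ • LV).comp (H1Linf.toH1L D) + LB), fun ψ φ => ?_⟩
  have hAψ : P.A v.toH1 u ψ = ∫ x in D, inner ℝ ((P.deg (v.toH1.val x)
      * P.weight (u.grad x) (v.toH1.val x)) • u.grad x) (ψ.grad x) :=
    integral_congr_ae (Eventually.of_forall fun x => densityA_eq v.toH1 u ψ x)
  have hBφ := B_eq hα hβ u v φ
  have e1 := eA ψ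
  have e2 := eG φ.toH1
  have e3 := eV φ.toH1
  have e4 := eB φ
  change LA ψ + (2 * P.ρ * LG φ.toH1 - P.δ * LV φ.toH1 + LB φ) = _
  linear_combination e1 - hAψ + 2 * P.ρ * e2 - P.δ * e3 + e4 - hBφ

end derivative
end Params

/-! ### The remainder estimate and Fréchet differentiability -/

/-- A first-order remainder of the form `‖z - x‖ θ(z)` with `θ → 0` at `x` gives Fréchet
differentiability at `x`. -/
theorem hasFDerivAt_of_abs_remainder_le {E : Type*} [NormedAddCommGroup E] [NormedSpace ℝ E]
    {f θ : E → ℝ} {L : E →L[ℝ] ℝ} {x : E} (hθ : Tendsto θ (𝓝 x) (𝓝 0))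
    (h : ∀ z, ‖z - x‖ ≤ 1 → |f z - f x - L (z - x)| ≤ ‖z - x‖ * θ z) : HasFDerivAt f L x := by
  rw [hasFDerivAt_iff_isLittleO, Asymptotics.isLittleO_iff]
  intro c hc
  filter_upwards [hθ.eventually (gt_mem_nhds hc),
    (tendsto_norm_sub_self x).eventually (gt_mem_nhds one_pos)] with z h1 h2
  rw [Real.norm_eq_abs, mul_comm c]
  exact (h z h2.le).trans (mul_le_mul_of_nonneg_left h1.le (norm_nonneg _))

namespace Params

variable {d : ℕ} {D : Set (Sp d)} {P : Params}

section remainder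

/-- The total increment of the weight against `|∇u|²` vanishes as the argument of the energy
approaches `(u, v)`. -/
theorem tendsto_weight_increment (hα : 0 < P.α) (hβ : 0 ≤ P.β) (u : H1 D) (v : H1Linf D) :
    Tendsto (fun z : H1 D × H1Linf D =>
      ∫ x in D, |P.weight (z.1.grad x) (z.2.toH1.val x)
        - P.weight (u.grad x) (v.toH1.val x)| * ‖u.grad x‖ ^ 2) (𝓝 (u, v)) (𝓝 0) := by
  have hc : Tendsto (fun z : H1 D × H1Linf D => (z.1, z.2.toH1)) (𝓝 (u, v))
      (𝓝 (u, v.toH1)) :=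
    (continuous_fst.tendsto (u, v)).prodMk_nhds
      ((H1Linf.continuous_toH1.tendsto v).comp (continuous_snd.tendsto (u, v)))
  have h1 := continuous_weight (d := d) hα hβ
  have h2 := abs_weight_sub_le_one (d := d) hα hβ
  have h3 : ∀ x, 0 ≤ ‖u.grad x‖ ^ 2 := fun x => sq_nonneg _
  have h4 := tendsto_integral_abs_sub_mul (k := P.weight) h1 h2 u.integrable_norm_grad_sq h3
    u v.toH1
  have h5 := h4.comp hc
  exact h5

variable (hα : 0 < P.α) (hβ : 0 ≤ P.β) (hκ : 0 < P.κ) (hκ1 : P.κ < 1)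
include hα hβ hκ hκ1

/-- Pointwise bound for the first-order remainder of the full energy density. -/
theorem ae_abs_density_remainder_le (u u' : H1 D) (v v' : H1Linf D) (h1 : ‖v' - v‖ ≤ 1) :
    ∀ᵐ x ∂(volume.restrict D),
      |P.density u' v'.toH1 x - P.density u v.toH1 x
          - (P.densityA v.toH1 u (u' - u) x + P.densityB u v.toH1 (v' - v).toH1 x)|
        ≤ 2 * ((‖v‖ + 1) ^ 2 + 1)
              * (‖(u' - u).grad x‖ ^ 2 + ‖v' - v‖ ^ 2 * ‖u.grad x‖ ^ 2)
          + ((‖v‖ + 1) ^ 2 + 1)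
              * (|P.weight (u'.grad x) (v'.toH1.val x) - P.weight (u.grad x) (v.toH1.val x)|
                    * ‖u.grad x‖ * ‖(u' - u).grad x‖
                + ‖v' - v‖ * (|P.weight (u'.grad x) (v'.toH1.val x)
                    - P.weight (u.grad x) (v.toH1.val x)| * ‖u.grad x‖ ^ 2))
          + |P.ρ| * ‖(v' - v).toH1.grad x‖ ^ 2 := by
  filter_upwards [v.ae_abs_val_le, (v' - v).ae_abs_val_le, H1.grad_sub u' u,
    H1.grad_sub v'.toH1 v.toH1, H1.val_sub v'.toH1 v.toH1] with x e1 e2 e3 e4 e5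
  have hsub : (v' - v).toH1 = v'.toH1 - v.toH1 := rfl
  rw [← hsub] at e4 e5
  rw [e5] at e2
  have key := abs_bulk_remainder_le hα hβ hκ hκ1 (p := u.grad x) (p' := u'.grad x) e1 e2 h1
  have hn : ‖v'.toH1.grad x‖ ^ 2 = ‖v.toH1.grad x‖ ^ 2
      + 2 * inner ℝ (v.toH1.grad x) (v'.toH1.grad x - v.toH1.grad x)
      + ‖v'.toH1.grad x - v.toH1.grad x‖ ^ 2 := by
    rw [← norm_add_sq_real, add_sub_cancel]
  rw [density_eq, density_eq, densityA_eq, densityB_eq, real_inner_smul_left, e3, e4, e5, hn]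
  refine le_trans (le_of_eq ?_) ((abs_add_le _ _).trans (add_le_add key
    (le_of_eq ((abs_mul P.ρ (‖v'.toH1.grad x - v.toH1.grad x‖ ^ 2)).trans (by
      rw [abs_of_nonneg (sq_nonneg ‖v'.toH1.grad x - v.toH1.grad x‖)])))))
  congr 1
  ring

set_option maxHeartbeats 400000 in
/-- Integrated bound for the first-order remainder of the energy. -/
theorem abs_J_remainder_le [IsFiniteMeasure (volume.restrict D)] (u u' : H1 D) (v v' : H1Linf D)
    {R W : ℝ} (hu : ‖u' - u‖ ≤ R) (hv : ‖v' - v‖ ≤ R) (hR : R ≤ 1)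
    (hW : W = ∫ x in D, |P.weight (u'.grad x) (v'.toH1.val x)
      - P.weight (u.grad x) (v.toH1.val x)| * ‖u.grad x‖ ^ 2) :
    |P.J u' v'.toH1 - P.J u v.toH1
        - (P.A v.toH1 u (u' - u) + P.B u v.toH1 (v' - v).toH1)|
      ≤ R * ((2 * ((‖v‖ + 1) ^ 2 + 1) * (1 + ∫ x in D, ‖u.grad x‖ ^ 2) + |P.ρ|) * R
        + ((‖v‖ + 1) ^ 2 + 1) * (√W + W)) := by
  have hR0 : 0 ≤ R := (norm_nonneg _).trans hu
  set θ : Sp d → ℝ := fun x => |P.weight (u'.grad x) (v'.toH1.val x)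
      - P.weight (u.grad x) (v.toH1.val x)| with hθ
  have hθ0 : ∀ x, 0 ≤ θ x := fun x => abs_nonneg _
  have hθ1 : ∀ x, θ x ≤ 1 := fun x => abs_weight_sub_le_one hα hβ _ _ _ _
  have mθ : AEStronglyMeasurable θ (volume.restrict D) :=
    ((aestronglyMeasurable_weight hα hβ u' v'.toH1).sub
      (aestronglyMeasurable_weight hα hβ u v.toH1)).norm
  have ia := u.integrable_norm_grad_sq
  have ib := (u' - u).integrable_norm_grad_sq
  have ic := (v' - v).toH1.integrable_norm_grad_sq
  have iW : Integrable (fun x => θ x * ‖u.grad x‖ ^ 2) (volume.restrict D) :=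
    ia.bdd_mul (c := 1) mθ (Eventually.of_forall fun x => by
      rw [Real.norm_eq_abs, abs_of_nonneg (hθ0 x)]; exact hθ1 x)
  have mθa : MemLp (fun x => θ x * ‖u.grad x‖) 2 (volume.restrict D) := by
    refine u.memLp_grad.of_le (mθ.mul u.memLp_grad.1.norm) (Eventually.of_forall fun x => ?_)
    rw [norm_mul, norm_norm, Real.norm_eq_abs, abs_of_nonneg (hθ0 x)]
    exact mul_le_of_le_one_left (norm_nonneg _) (hθ1 x)
  have iab : Integrable (fun x => θ x * ‖u.grad x‖ * ‖(u' - u).grad x‖) (volume.restrict D) :=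
    mθa.integrable_mul (u' - u).memLp_grad.norm
  have hW0 : 0 ≤ W := by
    rw [hW]; exact integral_nonneg fun x => mul_nonneg (hθ0 x) (sq_nonneg _)
  have hbR : ∫ x in D, ‖(u' - u).grad x‖ ^ 2 ≤ R ^ 2 :=
    (u' - u).integral_norm_grad_sq_le.trans (pow_le_pow_left₀ (norm_nonneg _) hu 2)
  have hcR : ∫ x in D, ‖(v' - v).toH1.grad x‖ ^ 2 ≤ R ^ 2 :=
    (v' - v).toH1.integral_norm_grad_sq_le.trans
      (pow_le_pow_left₀ (norm_nonneg _) ((v' - v).norm_toH1_le.trans hv) 2)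
  have hab : ∫ x in D, θ x * ‖u.grad x‖ * ‖(u' - u).grad x‖ ≤ √W * R := by
    have h := integral_mul_le_Lp_mul_Lq_of_nonneg (μ := volume.restrict D)
      (f := fun x => θ x * ‖u.grad x‖) (g := fun x => ‖(u' - u).grad x‖)
      Real.HolderConjugate.two_two
      (Eventually.of_forall fun x => mul_nonneg (hθ0 x) (norm_nonneg _))
      (Eventually.of_forall fun x => norm_nonneg _) (by simpa using mθa)
      (by simpa using (u' - u).memLp_grad.norm)
    simp only [Real.rpow_two, ← Real.sqrt_eq_rpow] at h
    refine h.trans (mul_le_mul (Real.sqrt_le_sqrt ?_) (Real.sqrt_le_iff.2 ⟨hR0, hbR⟩)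
      (Real.sqrt_nonneg _) (Real.sqrt_nonneg _))
    rw [hW]
    refine integral_mono mθa.integrable_sq iW fun x => ?_
    -- `θ² ≤ θ` since `0 ≤ θ ≤ 1`
    have h2 : θ x ^ 2 ≤ θ x := by nlinarith [hθ0 x, hθ1 x]
    simpa [mul_pow] using mul_le_mul_of_nonneg_right h2 (sq_nonneg ‖u.grad x‖)
  have iJ := integrable_density hα hβ hκ hκ1 u v
  have iJ' := integrable_density hα hβ hκ hκ1 u' v'
  have iA := integrable_densityA hα hβ hκ hκ1 u v (u' - u)
  have iB := integrable_densityB hα hβ u v (v' - v)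
  have split : P.J u' v'.toH1 - P.J u v.toH1
        - (P.A v.toH1 u (u' - u) + P.B u v.toH1 (v' - v).toH1)
      = ∫ x in D, (P.density u' v'.toH1 x - P.density u v.toH1 x
          - (P.densityA v.toH1 u (u' - u) x + P.densityB u v.toH1 (v' - v).toH1 x)) := by
    have i1 : Integrable (fun x => P.density u' v'.toH1 x - P.density u v.toH1 x)
      (volume.restrict D) := iJ'.sub iJ
    have i2 : Integrable (fun x => P.densityA v.toH1 u (u' - u) x
      + P.densityB u v.toH1 (v' - v).toH1 x) (volume.restrict D) := iA.add iB
    rw [integral_sub i1 i2, integral_sub iJ' iJ, integral_add iA iB]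
    rfl
  set G := (‖v‖ + 1) ^ 2 + 1
  have hG : 0 ≤ G := by positivity
  set S := ‖v' - v‖
  have hS : 0 ≤ S := norm_nonneg _
  have i1 : Integrable (fun x => 2 * G * (‖(u' - u).grad x‖ ^ 2 + S ^ 2 * ‖u.grad x‖ ^ 2))
      (volume.restrict D) := (ib.add (ia.const_mul _)).const_mul _
  have i2 : Integrable (fun x => G * (θ x * ‖u.grad x‖ * ‖(u' - u).grad x‖
      + S * (θ x * ‖u.grad x‖ ^ 2))) (volume.restrict D) :=
    (iab.add (iW.const_mul _)).const_mul _
  have i3 : Integrable (fun x => |P.ρ| * ‖(v' - v).toH1.grad x‖ ^ 2) (volume.restrict D) :=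
    ic.const_mul _
  have i12 : Integrable (fun x => 2 * G * (‖(u' - u).grad x‖ ^ 2 + S ^ 2 * ‖u.grad x‖ ^ 2)
      + G * (θ x * ‖u.grad x‖ * ‖(u' - u).grad x‖ + S * (θ x * ‖u.grad x‖ ^ 2)))
      (volume.restrict D) := i1.add i2
  have i123 : Integrable (fun x => 2 * G * (‖(u' - u).grad x‖ ^ 2 + S ^ 2 * ‖u.grad x‖ ^ 2)
      + G * (θ x * ‖u.grad x‖ * ‖(u' - u).grad x‖ + S * (θ x * ‖u.grad x‖ ^ 2))
      + |P.ρ| * ‖(v' - v).toH1.grad x‖ ^ 2) (volume.restrict D) := i12.add i3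
  rw [split, ← Real.norm_eq_abs]
  refine (norm_integral_le_of_norm_le i123
    (ae_abs_density_remainder_le hα hβ hκ hκ1 u u' v v' (hv.trans hR))).trans ?_
  rw [integral_add i12 i3, integral_add i1 i2, integral_const_mul, integral_const_mul,
    integral_const_mul, integral_add ib (ia.const_mul _), integral_add iab (iW.const_mul _),
    integral_const_mul, integral_const_mul, ← hW]
  have hA0 : 0 ≤ ∫ x in D, ‖u.grad x‖ ^ 2 := integral_nonneg fun x => sq_nonneg _
  have b1 : S ^ 2 * ∫ x in D, ‖u.grad x‖ ^ 2 ≤ R ^ 2 * ∫ x in D, ‖u.grad x‖ ^ 2 :=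
    mul_le_mul_of_nonneg_right (pow_le_pow_left₀ hS hv 2) hA0
  have b2 : S * W ≤ R * W := mul_le_mul_of_nonneg_right hv hW0
  have c1 := mul_le_mul_of_nonneg_left (add_le_add hbR b1) (by positivity : 0 ≤ 2 * G)
  have c2 := mul_le_mul_of_nonneg_left (add_le_add hab b2) hG
  have c3 := mul_le_mul_of_nonneg_left hcR (abs_nonneg P.ρ)
  refine (add_le_add (add_le_add c1 c2) c3).trans (le_of_eq ?_)
  ring

/-- The derivative of the energy at `(u, v)`. The remainder is `‖z - (u, v)‖` times a quantity that
tends to zero by `tendsto_weight_increment`. -/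
theorem hasFDerivAt_J [IsFiniteMeasure (volume.restrict D)] (u : H1 D) (v : H1Linf D)
    {L : H1 D × H1Linf D →L[ℝ] ℝ}
    (hL : ∀ ψ φ, L (ψ, φ) = P.A v.toH1 u ψ + P.B u v.toH1 φ.toH1) :
    HasFDerivAt (fun w : H1 D × H1Linf D => P.J w.1 w.2.toH1) L (u, v) := by
  have limW := tendsto_weight_increment hα hβ u v
  have lim := ((tendsto_norm_sub_self ((u, v) : H1 D × H1Linf D)).const_mul (2 * ((‖v‖ + 1) ^ 2 + 1) *
    (1 + ∫ x in D, ‖u.grad x‖ ^ 2) + |P.ρ|)).add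
      ((limW.sqrt.add limW).const_mul ((‖v‖ + 1) ^ 2 + 1))
  simp only [Real.sqrt_zero, add_zero, mul_zero] at lim
  -- The instances are given explicitly: the topology that `HasFDerivAt` sees on the product is the
  -- subspace topology, which agrees with the norm topology only after unfolding.
  refine @hasFDerivAt_of_abs_remainder_le (H1 D × H1Linf D) inferInstance inferInstance
    _ _ L (u, v) lim fun z hz => ?_
  have e := hL (z.1 - u) (z.2 - v)
  have h := abs_J_remainder_le hα hβ hκ hκ1 u z.1 v z.2
    (norm_fst_le (z - (u, v))) (norm_snd_le (z - (u, v))) hz rfl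
  rw [← e] at h
  exact h

end remainder
end Params
end PhaseField

theorem mainTheorem4 {d : ℕ} (D : Set (PhaseField.Sp d)) (hD : IsOpen D)
    (hDb : Bornology.IsBounded D) (P : PhaseField.Params)
    (hα : 0 < P.α) (hβ : 0 ≤ P.β) (hκ : 0 < P.κ) (hκ1 : P.κ < 1) (hε : 0 < P.ε)
    (u : PhaseField.H1 D) (v : PhaseField.H1Linf D) :
    -- the integral defining the energy converges, so that `J(u, v)` is a real number
    IntegrableOn (P.density u v.toH1) D ∧
    -- so do the integrals defining `A(v; u, ψ)` and `B(u; v, φ)`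
    (∀ ψ : PhaseField.H1 D, IntegrableOn (P.densityA v.toH1 u ψ) D) ∧
    (∀ φ : PhaseField.H1Linf D, IntegrableOn (P.densityB u v.toH1 φ.toH1) D) ∧
    -- `J` is Fréchet differentiable at `(u, v)` with derivative `A(v; u, ψ) + B(u; v, φ)`
    ∃ L : PhaseField.H1 D × PhaseField.H1Linf D →L[ℝ] ℝ,
      (∀ (ψ : PhaseField.H1 D) (φ : PhaseField.H1Linf D),
        L (ψ, φ) = P.A v.toH1 u ψ + P.B u v.toH1 φ.toH1) ∧
      HasFDerivAt
        (fun w : PhaseField.H1 D × PhaseField.H1Linf D => P.J w.1 w.2.toH1) L (u, v) := by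
  have : IsFiniteMeasure (volume.restrict D) :=
    isFiniteMeasure_restrict.2 hDb.measure_lt_top.ne
  obtain ⟨L, hL⟩ := PhaseField.Params.exists_clm_eq_A_add_B hα hβ hκ hκ1 u v
  exact ⟨PhaseField.Params.integrable_density hα hβ hκ hκ1 u v,
    fun ψ => PhaseField.Params.integrable_densityA hα hβ hκ hκ1 u v ψ,
    fun φ => PhaseField.Params.integrable_densityB hα hβ u v φ,
    L, hL, PhaseField.Params.hasFDerivAt_J hα hβ hκ hκ1 u v hL⟩
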